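/- Let $\mathcal F$ be the set of functions $f:[0,1]^2\to[0,1]$ that are non-increasing in the first argument, non-decreasing in the second argument, and satisfy $f(x,1)=1$ for all $x\in[0,1]$ and $f(1,y)=0$ for all $y\in[0,1)$. Let $G=(L,R,E)$ be a finite bipartite graph with offline vertices $L$, online vertices $R$ and weights $w_v\ge 0$ for $v\in L$. The vertex-weighted Ranking algorithm with pricing function $f$ works as follows: every $v\in L$ draws a rank $y_v$ and every $u\in R$ draws an arrival time $x_u$, all independently and uniformly from $[0,1]$; the online vertices are processed in increasing order of arrival time, and each $u$ is matched upon its arrival, if it has an unmatched neighbour, to the unmatched neighbour $v$ that maximizes $w_v\,(1-f(x_u,y_v))$, where ties are broken by a fixed linear order on $L$. Let $\mathrm{ALG}_f(G)$ be the total weight of the offline vertices matched by the algorithm, and let $\mathrm{OPT}(G)$ be the maximum over all matchings of $G$ of the total weight of the matched offline vertices. Theorem. Ranking is at least $0.6862$-competitive for vertex-weighted online bipartite matching with random arrivals: there is a function $f\in\mathcal F$ such that for every finite vertex-weighted bipartite graph $G$ and every tie-breaking order on $L$, $$\mathbb{E}_{x,y}\big[\mathrm{ALG}_f(G)\big]\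 \ge\ 0.6862\cdot \mathrm{OPT}(G).$$ -/

import Mathlib

open MeasureTheory

universe u v

namespace OnlineMatching

/-- A vertex-weighted bipartite graph `G = (L, R, E)`: `L` is the set of offline vertices, `R` the
set of online vertices, and every offline vertex carries a non-negative weight. -/
structure WeightedBipartite (L : Type u) (R : Type v) where
  /-- The edges, written as pairs (offline vertex, online vertex). -/
  edges : Finset (L × R)
  /-- The weights of the offline vertices. -/
  weight : L → ℝ
  weight_nonneg : ∀ a, 0 ≤ weight a

/-- The class `𝓕` of functions `f : [0,1]² → [0,1]` that characterize a vertex-weighted Ranking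
algorithm: the first argument is an arrival time, the second one a rank. -/
structure IsPricing (f : unitInterval → unitInterval → unitInterval) : Prop where
  antitone_time : ∀ y, Antitone fun x => f x y
  monotone_rank : ∀ x, Monotone (f x)
  rank_one : ∀ x, f x 1 = 1
  time_one : ∀ y, y < 1 → f 1 y = 0

namespace WeightedBipartite

variable {L : Type u} {R : Type v}

/-- A matching: a set of edges, no two of which share an endpoint. -/
def IsMatching (G : WeightedBipartite L R) (M : Finset (L × R)) : Prop :=
  M ⊆ G.edges ∧ ∀ e ∈ M, ∀ e' ∈ M, e.1 = e'.1 ∨ e.2 = e'.2 → e = e'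

/-- The value of a set of edges: the total weight of their offline endpoints. -/
def value (G : WeightedBipartite L R) (M : Finset (L × R)) : ℝ :=
  ∑ e ∈ M, G.weight e.1

open Classical in
/-- The offline optimum: the maximum value of a matching of `G`. -/
noncomputable def opt (G : WeightedBipartite L R) : ℝ :=
  (G.edges.powerset.filter G.IsMatching).sup'
    ⟨∅, by simp [IsMatching]⟩ G.value

section Ranking

variable [Fintype L] [LinearOrder L] [Fintype R] [LinearOrder R]

/-- The neighbours of the online vertex `b` that are not matched in `M`. -/
def available (G : WeightedBipartite L R) (M : Finset (L × R)) (b : R) : Finset L :=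
  Finset.univ.filter fun a => (a, b) ∈ G.edges ∧ ∀ e ∈ M, e.1 ≠ a

/-- The priority of the offline vertex `a` for the online vertex `b`, at arrival times `x` and
ranks `y`: the number `w_a * (1 - f (x_b) (y_a))`, ties being broken by the order of `L`. -/
noncomputable def priority (G : WeightedBipartite L R)
    (f : unitInterval → unitInterval → unitInterval)
    (x : R → unitInterval) (y : L → unitInterval) (b : R) (a : L) : ℝ ×ₗ L :=
  toLex (G.weight a * (1 - (f (x b) (y a) : ℝ)), a)

/-- The arrival of the online vertex `b` when `M` is the set of edges matched so far: `b` is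
matched to its unmatched neighbour of highest priority, if it has an unmatched neighbour. -/
noncomputable def arrive (G : WeightedBipartite L R)
    (f : unitInterval → unitInterval → unitInterval)
    (x : R → unitInterval) (y : L → unitInterval) (M : Finset (L × R)) (b : R) :
    Finset (L × R) :=
  if h : (G.available M b).Nonempty then
    insert ((Finset.exists_max_image (G.available M b) (G.priority f x y b) h).choose, b) M
  else M

/-- The online vertices in the order of their arrival times (two vertices with the same arrival
time, an event of probability zero, are ordered by the order of `R`). -/
noncomputable def arrivalOrder (x : R → unitInterval) : List R :=
  ((Finset.univ : Finset R).sort (· ≤ ·)).insertionSort fun b b' => x b ≤ x b'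

/-- The matching that Ranking with pricing function `f` returns for the arrival times `x` and the
ranks `y`. -/
noncomputable def ranking (G : WeightedBipartite L R)
    (f : unitInterval → unitInterval → unitInterval)
    (x : R → unitInterval) (y : L → unitInterval) : Finset (L × R) :=
  (arrivalOrder x).foldl (G.arrive f x y) ∅

/-- The value of Ranking as a random variable: the sample space is the cube of all arrival times
`p.1` and ranks `p.2`, under its Lebesgue measure all of these are independent and uniform. -/
noncomputable def rankingValue (G : WeightedBipartite L R)
    (f : unitInterval → unitInterval → unitInterval)
    (p : (R → unitInterval) × (L → unitInterval)) : ℝ :=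
  G.value (G.ranking f p.1 p.2)

end Ranking

end WeightedBipartite

end OnlineMatching

/-! The argument is randomized primal-dual. When `b` takes `a`, the weight `w a` is split into a
share `w a * F` for `a` and a share `w a * (1 - F)` for `b`. Summed over the edges of an optimal
matching, the shares of the endpoints never exceed the value of Ranking (`sum_gain_le`), so it
suffices that the endpoints of every edge gain `0.6862 * w a` in expectation.

Fix an edge and all randomness except the arrival time of `b`, in cell `i`, and the rank of `a`, in
cell `j`. Let `t` be the cell of the time at which `a` is matched without `b`, and `θ` the rank cell
from which on `a` does not beat what `b` gets without `a`. If `i < t` and `j < θ`, the two are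
matched to each other and share all of `w a`; otherwise, per unit of `w a`, `b` gets at least `1 - F
i θ` and `a` at least `F t j`, or `0` if `t` says unmatched (`pairGain_le`). The crucial
independence: `θ` ignores the rank of `a` (`critCell_update`) and `t` ignores the arrival of `b`
(`matchCell_update`).

So `pairGain` has to be averaged over `i` and `j` against arbitrary functions `θ` of `i` and `t` of
`j`, a finite problem since `F` is a step function on a 12 × 12 grid. A dual certificate decouples
it (`le_integral_gain`): `pairGain` is at least `rowTerm i j θ + colTerm i j t`, up to the scaling
by 1000; the first is summed over `j` for each fixed `i` and `θ`, the second over `i` for each fixed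
`j` and `t`. The resulting bounds total 98.813 over 144 cells, just above 0.6862 per cell. The price
table satisfies `F i j + F j i = 1`, which makes the column bounds the row bounds minus 12. -/

namespace OnlineMatching

/-! ### Greedy matching and its stability under adding a vertex -/

section Greedy

variable {L : Type*} {R : Type*} {α : Type*} [LinearOrder α]

/-- The element of `A` with the highest priority, if `A` is nonempty. -/
noncomputable def best (pr : L → α) (A : Finset L) : Option L :=
  if h : A.Nonempty then some (Finset.exists_max_image A pr h).choose else none

theorem best_spec {pr : L → α} {A : Finset L} {a : L} (h : best pr A = some a) :
    a ∈ A ∧ ∀ c ∈ A, pr c ≤ pr a := by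
  unfold best at h
  split_ifs at h with hA
  obtain rfl := Option.some.inj h
  exact (Finset.exists_max_image A pr hA).choose_spec

theorem best_eq_none {pr : L → α} {A : Finset L} : best pr A = none ↔ A = ∅ := by
  unfold best
  split_ifs with hA
  · simpa using hA.ne_empty
  · simpa using hA

theorem best_isSome {pr : L → α} {A : Finset L} {c : L} (h : c ∈ A) :
    ∃ a, best pr A = some a := by
  cases hb : best pr A with
  | none => simp [best_eq_none.1 hb] at h
  | some a => exact ⟨a, rfl⟩

theorem best_eq_some {pr : L → α} (hpr : Function.Injective pr) {A : Finset L} {a : L}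
    (ha : a ∈ A) (hmax : ∀ c ∈ A, pr c ≤ pr a) : best pr A = some a := by
  obtain ⟨z, hz⟩ := best_isSome (pr := pr) ha
  obtain ⟨hzA, hzmax⟩ := best_spec hz
  rw [hz, hpr (le_antisymm (hmax z hzA) (hzmax a ha))]

theorem best_congr {pr pr' : L → α} (hpr' : Function.Injective pr')
    {A : Finset L} (h : ∀ c ∈ A, pr c = pr' c) : best pr A = best pr' A := by
  cases hb : best pr A with
  | none => exact (best_eq_none.2 (best_eq_none.1 hb)).symm
  | some a =>
    obtain ⟨ha, hmax⟩ := best_spec hb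
    refine (best_eq_some hpr' ha fun c hc => ?_).symm
    rw [← h c hc, ← h a ha]
    exact hmax c hc

variable [DecidableEq L]

/-- The set of matched offline vertices after the arrival of `b`, when it was `S` before. -/
noncomputable def step (N : R → Finset L) (pr : R → L → α) (S : Finset L) (b : R) : Finset L :=
  S ∪ (best (pr b) (N b \ S)).toFinset

/-- The set of matched offline vertices after the arrivals `l`, when it was `S` before. -/
noncomputable def run (N : R → Finset L) (pr : R → L → α) (S : Finset L) (l : List R) : Finset L :=
  l.foldl (step N pr) S

variable {N : R → Finset L} {pr : R → L → α}

theorem run_cons (S : Finset L) (b : R) (l : List R) :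
    run N pr S (b :: l) = run N pr (step N pr S b) l := rfl

theorem run_append (S : Finset L) (l l' : List R) :
    run N pr S (l ++ l') = run N pr (run N pr S l) l' := by
  simp [run]

theorem subset_step (S : Finset L) (b : R) : S ⊆ step N pr S b := Finset.subset_union_left

theorem subset_run (S : Finset L) (l : List R) : S ⊆ run N pr S l := by
  induction l generalizing S with
  | nil => exact subset_rfl
  | cons b l ih => exact (subset_step S b).trans (ih _)

/-- `T` has at most one element more than `S`. -/
def Near (S T : Finset L) : Prop := T = S ∨ ∃ z, z ∉ S ∧ T = insert z S

theorem Near.subset {S T : Finset L} (h : Near S T) : S ⊆ T := by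
  rcases h with rfl | ⟨z, -, rfl⟩
  · exact subset_rfl
  · exact Finset.subset_insert _ _

theorem near_step_self (S : Finset L) (b : R) : Near S (step N pr S b) := by
  unfold step
  cases hb : best (pr b) (N b \ S) with
  | none => left; simp
  | some a =>
    right
    refine ⟨a, (Finset.mem_sdiff.1 (best_spec hb).1).2, ?_⟩
    ext; simp

/-- The alternating path argument: the two runs differ in one matched vertex `z`, and an arrival
either keeps this difference, moves it to another vertex or removes it. -/
theorem Near.step (hpr : ∀ b, Function.Injective (pr b)) {S T : Finset L} (h : Near S T) (b : R) :
    Near (step N pr S b) (step N pr T b) := by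
  rcases h with rfl | ⟨z, hz, rfl⟩
  · exact Or.inl rfl
  unfold OnlineMatching.step
  cases hS : best (pr b) (N b \ S) with
  | none =>
    have hS' := best_eq_none.1 hS
    have : N b \ insert z S = ∅ := by
      rw [Finset.sdiff_eq_empty_iff_subset] at hS' ⊢
      exact hS'.trans (Finset.subset_insert _ _)
    rw [best_eq_none.2 this]
    right
    exact ⟨z, by simpa using hz, by simp⟩
  | some c =>
    obtain ⟨hc, hmax⟩ := best_spec hS
    rw [Finset.mem_sdiff] at hc
    -- If the smaller run takes `z`, it catches up, and the choice of the other run, if any, is the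
    -- new difference; otherwise both runs choose `c`.
    by_cases hcz : c = z
    · subst hcz
      cases hT : best (pr b) (N b \ insert c S) with
      | none => left; ext; simp
      | some d =>
        have hd := (Finset.mem_sdiff.1 (best_spec hT).1).2
        right
        refine ⟨d, by simpa [or_comm] using hd, ?_⟩
        ext; simp; tauto
    · have : best (pr b) (N b \ insert z S) = some c := by
        refine best_eq_some (hpr b) (by simp [hc.1, hc.2, hcz]) fun d hd => hmax d ?_
        simp only [Finset.mem_sdiff, Finset.mem_insert, not_or] at hd ⊢
        exact ⟨hd.1, hd.2.2⟩
      rw [this]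
      right
      exact ⟨z, by simp [hz, Ne.symm hcz], by simp⟩

theorem Near.run (hpr : ∀ b, Function.Injective (pr b)) {S T : Finset L} (h : Near S T)
    (l : List R) : Near (run N pr S l) (run N pr T l) := by
  induction l generalizing S T with
  | nil => exact h
  | cons b l ih => exact ih (h.step hpr b)

theorem run_congr {pr' : R → L → α} (hpr' : ∀ b, Function.Injective (pr' b)) {S : Finset L}
    {l : List R} (h : ∀ b ∈ l, ∀ c ∉ S, pr b c = pr' b c) : run N pr S l = run N pr' S l := by
  induction l generalizing S with
  | nil => rfl
  | cons b l ih =>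
    rw [run_cons, run_cons]
    have : step N pr S b = step N pr' S b := by
      unfold step
      rw [best_congr (hpr' b) fun c hc => h b (by simp) c (Finset.mem_sdiff.1 hc).2]
    rw [this]
    exact ih fun b' hb' c hc => h b' (by simp [hb']) c fun hcS => hc (subset_step S b hcS)

/-- If `a` is free when `b` arrives, then the free vertices other than `a` are those that are free
when `a` is excluded from the beginning. -/
theorem run_singleton_of_notMem (hpr : ∀ b, Function.Injective (pr b)) {a : L} {l : List R}
    (ha : a ∉ run N pr ∅ l) : run N pr {a} l = insert a (run N pr ∅ l) := by
  have h : Near ∅ ({a} : Finset L) := Or.inr ⟨a, by simp, by simp⟩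
  have ha' : a ∈ run N pr {a} l := subset_run _ _ (by simp)
  rcases h.run (N := N) hpr l with h | ⟨z, -, h⟩
  · exact absurd (h ▸ ha') ha
  · rw [h, Finset.mem_insert] at ha'
    rcases ha' with rfl | ha'
    · exact h
    · exact absurd ha' ha

theorem run_empty_subset_run_singleton (hpr : ∀ b, Function.Injective (pr b)) (a : L)
    (l : List R) : run N pr ∅ l ⊆ run N pr {a} l :=
  (Near.run hpr (Or.inr ⟨a, by simp, by simp⟩) l).subset

variable [DecidableEq R]

/-- The matching found by greedy matching when the online vertices arrive in the order `l` and the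
edges `M` were chosen before. -/
noncomputable def runEdges (N : R → Finset L) (pr : R → L → α)
    (M : Finset (L × R)) (l : List R) : Finset (L × R) :=
  l.foldl (fun M b =>
    M ∪ ((best (pr b) (N b \ M.image Prod.fst)).map fun a => (a, b)).toFinset) M

theorem runEdges_append (M : Finset (L × R)) (l l' : List R) :
    runEdges N pr M (l ++ l') = runEdges N pr (runEdges N pr M l) l' := by
  simp [runEdges]

theorem subset_runEdges (M : Finset (L × R)) (l : List R) : M ⊆ runEdges N pr M l := by
  induction l generalizing M with
  | nil => exact subset_rfl
  | cons b l ih => exact Finset.subset_union_left.trans (ih _)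

theorem runEdges_singleton (M : Finset (L × R)) (b : R) : runEdges N pr M [b] =
    M ∪ ((best (pr b) (N b \ M.image Prod.fst)).map fun a => (a, b)).toFinset := rfl

theorem image_fst_runEdges (M : Finset (L × R)) (l : List R) :
    (runEdges N pr M l).image Prod.fst = run N pr (M.image Prod.fst) l := by
  induction l generalizing M with
  | nil => rfl
  | cons b l ih =>
    rw [run_cons]
    refine (ih _).trans ?_
    congr 1
    rw [Finset.image_union]
    unfold step
    congr 1
    cases best (pr b) (N b \ M.image Prod.fst) <;> simp

theorem image_fst_runEdges_empty (l : List R) :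
    (runEdges N pr ∅ l).image Prod.fst = run N pr ∅ l := by
  simpa using image_fst_runEdges (N := N) (pr := pr) ∅ l

theorem exists_prefix_of_mem_runEdges {a : L} {c : R} {l : List R}
    (h : (a, c) ∈ runEdges N pr ∅ l) :
    ∃ k k', l = k ++ c :: k' ∧ a ∈ run N pr ∅ (k ++ [c]) := by
  induction l using List.reverseRecOn with
  | nil => simp [runEdges] at h
  | append_singleton l b ih =>
    have h' := h
    rw [runEdges_append, runEdges_singleton, Finset.mem_union] at h
    rcases h with h | h
    · obtain ⟨k, k', rfl, hk⟩ := ih h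
      exact ⟨k, k' ++ [b], by simp, hk⟩
    · have hcb : c = b := by
        simp at h
        exact h.2.symm
      subst hcb
      refine ⟨l, [], rfl, ?_⟩
      rw [← image_fst_runEdges_empty]
      exact Finset.mem_image_of_mem Prod.fst h'

theorem exists_mem_runEdges {a : L} {l : List R} (h : a ∈ run N pr ∅ l) :
    ∃ c ∈ l, (a, c) ∈ runEdges N pr ∅ l := by
  rw [← image_fst_runEdges_empty, Finset.mem_image] at h
  obtain ⟨⟨a', c⟩, hac, rfl⟩ := h
  obtain ⟨k, k', rfl, -⟩ := exists_prefix_of_mem_runEdges hac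
  exact ⟨c, by simp, hac⟩

theorem mem_runEdges_of_best {z : L} {b : R} (l l' : List R)
    (h : best (pr b) (N b \ run N pr ∅ l) = some z) :
    (z, b) ∈ runEdges N pr ∅ (l ++ b :: l') := by
  rw [show l ++ b :: l' = (l ++ [b]) ++ l' by simp, runEdges_append]
  apply subset_runEdges
  rw [runEdges_append, runEdges_singleton, image_fst_runEdges_empty, h]
  simp

/-- An additional online vertex can only make the offline vertices be matched earlier. -/
theorem exists_earlier_of_insert (hpr : ∀ b, Function.Injective (pr b)) {T : R → R → Prop}
    (hT : ∀ c, T c c) {l l' : List R} {b : R} (hl : (l ++ b :: l').Pairwise T) {a : L} {c : R}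
    (hac : (a, c) ∈ runEdges N pr ∅ (l ++ l')) :
    ∃ d, T d c ∧ (a, d) ∈ runEdges N pr ∅ (l ++ b :: l') := by
  obtain ⟨k, k', hk, ha⟩ := exists_prefix_of_mem_runEdges hac
  -- It is enough to find a prefix of the longer list that matches `a` and contains no arrival later
  -- than `c`: the prefix up to `c`, which includes `b` or not according to the place of `c`.
  have key : ∃ m m', l ++ b :: l' = m ++ m' ∧ a ∈ run N pr ∅ m ∧ ∀ d ∈ m, T d c := by
    rw [show k ++ c :: k' = (k ++ [c]) ++ k' by simp, List.append_eq_append_iff] at hk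
    rcases hk with ⟨s, hs, rfl⟩ | ⟨s, rfl, rfl⟩
    · rcases s.eq_nil_or_concat with rfl | ⟨s, c', rfl⟩
      · refine ⟨l, b :: ([] ++ k'), by simp, ?_, ?_⟩ <;> rw [List.append_nil] at hs <;> subst hs
        · exact ha
        have := (List.pairwise_append.1 (List.pairwise_append.1 hl).1).2.2
        intro d hd
        rcases List.mem_append.1 hd with hd | hd
        · exact this d hd c (by simp)
        · rw [List.mem_singleton.1 hd]; exact hT c
      · rw [List.concat_eq_append] at hs hl ⊢
        rw [← List.append_assoc] at hs
        obtain ⟨rfl, hcc⟩ := List.append_inj' hs rfl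
        obtain rfl : c = c' := by simpa using hcc
        refine ⟨l ++ b :: (s ++ [c]), k', by simp, ?_, ?_⟩
        · rw [run_append, run_cons]
          rw [List.append_assoc, run_append] at ha
          exact ((near_step_self _ b).run hpr _).subset ha
        · intro d hd
          have hl' : ((l ++ b :: s) ++ (c :: k')).Pairwise T := by simpa using hl
          have := (List.pairwise_append.1 hl').2.2
          rw [show l ++ b :: (s ++ [c]) = (l ++ b :: s) ++ [c] by simp] at hd
          rcases List.mem_append.1 hd with hd | hd
          · exact this d hd c (by simp)
          · rw [List.mem_singleton.1 hd]; exact hT c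
    · refine ⟨k ++ [c], s ++ b :: l', by simp, ha, ?_⟩
      have hl' : (k ++ (c :: (s ++ b :: l'))).Pairwise T := by simpa using hl
      have := (List.pairwise_append.1 hl').2.2
      intro d hd
      rcases List.mem_append.1 hd with hd | hd
      · exact this d hd c (by simp)
      · rw [List.mem_singleton.1 hd]; exact hT c
  obtain ⟨m, m', hm, ham, hmT⟩ := key
  obtain ⟨d, hd, had⟩ := exists_mem_runEdges ham
  refine ⟨d, hmT d hd, ?_⟩
  rw [hm, runEdges_append]
  exact subset_runEdges _ _ had

end Greedy

/-- A table `F` of a pricing function that is constant on the cells of an `n × n` grid; the row and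
the column of index `n` hold the values at arrival time `1` and at rank `1`. -/
structure IsStepPricing (n : ℕ) (F : ℕ → ℕ → ℝ) : Prop where
  nonneg : ∀ i j, 0 ≤ F i j
  le_one : ∀ i j, F i j ≤ 1
  antitone : ∀ j, Antitone fun i => F i j
  monotone : ∀ i, Monotone (F i)
  last : ∀ i, F i n = 1

/-! ### Gain sharing and critical cells for fixed times and ranks -/

section Pointwise

variable {L : Type*} {R : Type*}

/-- The priority of `a` for `b`, when the arrival times and the ranks lie in the cells `i`, `j`. -/
noncomputable def stepPriority (w : L → ℝ) (F : ℕ → ℕ → ℝ) (i : R → ℕ) (j : L → ℕ) (b : R) (a : L) :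
    ℝ ×ₗ L :=
  toLex (w a * (1 - F (i b) (j a)), a)

theorem stepPriority_injective (w : L → ℝ) (F : ℕ → ℕ → ℝ) (i : R → ℕ) (j : L → ℕ) (b : R) :
    Function.Injective (stepPriority w F i j b) := by
  intro a a' h
  exact congrArg Prod.snd (toLex_inj.1 h)

theorem le_of_stepPriority_le [LinearOrder L] {w : L → ℝ} {F : ℕ → ℕ → ℝ}
    {i : R → ℕ} {j : L → ℕ} {b : R} {a c : L}
    (h : stepPriority w F i j b a ≤ stepPriority w F i j b c) :
    w a * (1 - F (i b) (j a)) ≤ w c * (1 - F (i b) (j c)) := by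
  rcases (Prod.Lex.toLex_le_toLex).1 h with h | h
  · exact h.le
  · exact h.1.le

/-- The share of the weight of `a` that `a` keeps, if it is matched in `M`. -/
noncomputable def offlineGain [DecidableEq L] (w : L → ℝ) (F : ℕ → ℕ → ℝ)
    (M : Finset (L × R)) (i : R → ℕ) (j : L → ℕ) (a : L) : ℝ :=
  ∑ e ∈ M with e.1 = a, w e.1 * F (i e.2) (j e.1)

/-- The share of the weight of its partner that `b` receives, if it is matched in `M`. -/
noncomputable def onlineGain [DecidableEq R] (w : L → ℝ) (F : ℕ → ℕ → ℝ)
    (M : Finset (L × R)) (i : R → ℕ) (j : L → ℕ) (b : R) : ℝ :=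
  ∑ e ∈ M with e.2 = b, w e.1 * (1 - F (i e.2) (j e.1))

variable {n : ℕ} {w : L → ℝ} {F : ℕ → ℕ → ℝ}

theorem offlineGain_nonneg [DecidableEq L] (hF : IsStepPricing n F) (hw : ∀ a, 0 ≤ w a)
    (M : Finset (L × R)) (i : R → ℕ) (j : L → ℕ) (a : L) : 0 ≤ offlineGain w F M i j a :=
  Finset.sum_nonneg fun _ _ => mul_nonneg (hw _) (hF.nonneg _ _)

theorem onlineGain_nonneg [DecidableEq R] (hF : IsStepPricing n F) (hw : ∀ a, 0 ≤ w a)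
    (M : Finset (L × R)) (i : R → ℕ) (j : L → ℕ) (b : R) : 0 ≤ onlineGain w F M i j b :=
  Finset.sum_nonneg fun _ _ => mul_nonneg (hw _) (sub_nonneg.2 (hF.le_one _ _))

theorem le_offlineGain [DecidableEq L] (hF : IsStepPricing n F) (hw : ∀ a, 0 ≤ w a)
    {M : Finset (L × R)} (i : R → ℕ) (j : L → ℕ) {a : L} {b : R} (h : (a, b) ∈ M) :
    w a * F (i b) (j a) ≤ offlineGain w F M i j a :=
  Finset.single_le_sum (s := {e ∈ M | e.1 = a}) (a := (a, b))
    (f := fun e : L × R => w e.1 * F (i e.2) (j e.1))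
    (fun _ _ => mul_nonneg (hw _) (hF.nonneg _ _)) (Finset.mem_filter.2 ⟨h, rfl⟩)

theorem le_onlineGain [DecidableEq R] (hF : IsStepPricing n F) (hw : ∀ a, 0 ≤ w a)
    {M : Finset (L × R)} (i : R → ℕ) (j : L → ℕ) {a : L} {b : R} (h : (a, b) ∈ M) :
    w a * (1 - F (i b) (j a)) ≤ onlineGain w F M i j b :=
  Finset.single_le_sum (s := {e ∈ M | e.2 = b}) (a := (a, b))
    (f := fun e : L × R => w e.1 * (1 - F (i e.2) (j e.1)))
    (fun _ _ => mul_nonneg (hw _) (sub_nonneg.2 (hF.le_one _ _))) (Finset.mem_filter.2 ⟨h, rfl⟩)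

variable [LinearOrder L] [DecidableEq R] (n w F) (N : R → Finset L)

/-- The matching found when the online vertices arrive in the order `l`. -/
noncomputable def stepEdges (l : List R) (i : R → ℕ) (j : L → ℕ) : Finset (L × R) :=
  runEdges N (stepPriority w F i j) ∅ l

/-- The cell of the time at which `a` is matched in the absence of `b`. -/
noncomputable def matchCell (a : L) (b : R) (l : List R) (i : R → ℕ) (j : L → ℕ) : ℕ :=
  sInf (insert n {t | ∃ c, (a, c) ∈ stepEdges w F N (l.filter (· ≠ b)) i j ∧ t = i c})

/-- The gain of `b` in the absence of `a`. -/
noncomputable def reserveGain (a : L) (b : R) (l : List R) (i : R → ℕ) (j : L → ℕ) : ℝ :=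
  (best (stepPriority w F i j b)
    (N b \ run N (stepPriority w F i j) {a} (l.takeWhile (· ≠ b)))).elim 0
      fun z => w z * (1 - F (i b) (j z))

/-- The least rank cell at which `a` is not strictly better for `b` than what `b` gains in the
absence of `a`. -/
noncomputable def critCell (a : L) (b : R) (l : List R) (i : R → ℕ) (j : L → ℕ) : ℕ :=
  sInf {k | w a * (1 - F (i b) k) ≤ reserveGain w F N a b l i j}

variable {n w F N}

theorem reserveGain_nonneg (hF : IsStepPricing n F) (hw : ∀ a, 0 ≤ w a) (a : L) (b : R)
    (l : List R) (i : R → ℕ) (j : L → ℕ) : 0 ≤ reserveGain w F N a b l i j := by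
  unfold reserveGain
  cases best (stepPriority w F i j b)
    (N b \ run N (stepPriority w F i j) {a} (l.takeWhile (· ≠ b))) with
  | none => exact le_rfl
  | some z => exact mul_nonneg (hw z) (sub_nonneg.2 (hF.le_one _ _))

theorem mem_critCell_set (hF : IsStepPricing n F) (hw : ∀ a, 0 ≤ w a) (a : L) (b : R)
    (l : List R) (i : R → ℕ) (j : L → ℕ) :
    n ∈ {k | w a * (1 - F (i b) k) ≤ reserveGain w F N a b l i j} := by
  simpa [hF.last] using reserveGain_nonneg hF hw a b l i j

theorem critCell_le (hF : IsStepPricing n F) (hw : ∀ a, 0 ≤ w a) (a : L) (b : R)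
    (l : List R) (i : R → ℕ) (j : L → ℕ) : critCell w F N a b l i j ≤ n :=
  Nat.sInf_le (mem_critCell_set hF hw a b l i j)

theorem le_reserveGain (hF : IsStepPricing n F) (hw : ∀ a, 0 ≤ w a) (a : L) (b : R)
    (l : List R) (i : R → ℕ) (j : L → ℕ) :
    w a * (1 - F (i b) (critCell w F N a b l i j)) ≤ reserveGain w F N a b l i j :=
  Nat.sInf_mem ⟨n, mem_critCell_set hF hw a b l i j⟩

theorem matchCell_le (a : L) (b : R) (l : List R) (i : R → ℕ) (j : L → ℕ) :
    matchCell n w F N a b l i j ≤ n :=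
  Nat.sInf_le (Set.mem_insert _ _)

/-- The gain that the pair `a`, `b` is certain to have in total, per unit of the weight of `a`: `i`
is the cell of the arrival time of `b`, `j` that of the rank of `a`, and `t`, `θ` are their critical
cells. -/
noncomputable def pairGain (n : ℕ) (F : ℕ → ℕ → ℝ) (i j t θ : ℕ) : ℝ :=
  if i < t ∧ j < θ then 1 else 1 - F i θ + if t = n then 0 else F t j

/-- Two monotonicity facts give the second case: the presence of `b` can only move the match of `a`
earlier, where `F` is larger, and the presence of `a` leaves `b` with at least as many free
neighbours. Cells do not reveal the order within a cell, so `i b = t` falls under this weaker bound.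
-/
theorem pairGain_le (hF : IsStepPricing n F) (hw : ∀ a, 0 ≤ w a) {l : List R} (hl : l.Nodup)
    {i : R → ℕ} (hi : l.Pairwise fun c d => i c ≤ i d) (j : L → ℕ) {a : L} {b : R} (hb : b ∈ l)
    (hab : a ∈ N b) :
    w a * pairGain n F (i b) (j a) (matchCell n w F N a b l i j) (critCell w F N a b l i j) ≤
      offlineGain w F (stepEdges w F N l i j) i j a +
        onlineGain w F (stepEdges w F N l i j) i j b := by
  have hpr := stepPriority_injective w F i j
  set t := matchCell n w F N a b l i j with ht
  set θ := critCell w F N a b l i j with hθ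
  have hcrit := le_reserveGain (N := N) hF hw a b l i j
  rw [← hθ] at hcrit
  obtain ⟨k, k', rfl⟩ := List.append_of_mem hb
  have hbk : ∀ c ∈ k, c ≠ b := by
    rintro c hc rfl
    exact (List.nodup_append.1 hl).2.2 c hc c (by simp) rfl
  have hbk' : ∀ c ∈ k', c ≠ b := by
    rintro c hc rfl
    exact (List.nodup_cons.1 (List.nodup_append.1 hl).2.1).1 hc
  have htake : (k ++ b :: k').takeWhile (· ≠ b) = k := by
    rw [List.takeWhile_append_of_pos (by simpa using hbk)]
    simp
  have hfilter : (k ++ b :: k').filter (· ≠ b) = k ++ k' := by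
    rw [List.filter_append, List.filter_cons_of_neg (by simp),
      List.filter_eq_self.2 (by simpa using hbk), List.filter_eq_self.2 (by simpa using hbk')]
  have hoff : w a * (if t = n then 0 else F t (j a)) ≤
      offlineGain w F (stepEdges w F N (k ++ b :: k') i j) i j a := by
    split_ifs with htn
    · simpa using offlineGain_nonneg hF hw _ i j a
    have hmem : t ∈ _ := Nat.sInf_mem ⟨n, Set.mem_insert n
      {t | ∃ c, (a, c) ∈ stepEdges w F N ((k ++ b :: k').filter (· ≠ b)) i j ∧ t = i c}⟩
    rcases hmem with h | ⟨c, hc, htc⟩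
    · exact absurd h htn
    rw [hfilter] at hc
    obtain ⟨d, hdc, hd⟩ := exists_earlier_of_insert (T := fun c d => i c ≤ i d) hpr
      (fun _ => le_rfl) hi hc
    refine le_trans ?_ (le_offlineGain hF hw i j hd)
    rw [htc]
    exact mul_le_mul_of_nonneg_left (hF.antitone _ hdc) (hw a)
  have hres : reserveGain w F N a b (k ++ b :: k') i j ≤
      onlineGain w F (stepEdges w F N (k ++ b :: k') i j) i j b := by
    unfold reserveGain
    rw [htake]
    cases hz : best (stepPriority w F i j b) (N b \ run N (stepPriority w F i j) {a} k) with
    | none => exact onlineGain_nonneg hF hw _ i j b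
    | some z =>
      have hzN := Finset.mem_sdiff.1 (best_spec hz).1
      have hzN' : z ∈ N b \ run N (stepPriority w F i j) ∅ k :=
        Finset.mem_sdiff.2 ⟨hzN.1, fun h => hzN.2 (run_empty_subset_run_singleton hpr a k h)⟩
      obtain ⟨c, hc⟩ := best_isSome (pr := stepPriority w F i j b) hzN'
      exact (le_of_stepPriority_le ((best_spec hc).2 z hzN')).trans
        (le_onlineGain hF hw i j (mem_runEdges_of_best k k' hc))
  unfold pairGain
  by_cases hcase : i b < t ∧ j a < θ
  · rw [if_pos hcase]
    obtain ⟨hit, hjθ⟩ := hcase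
    -- Before `b` arrives the runs with and without `b` agree, so an earlier match of `a` would give
    -- `t ≤ i b`.
    have hak : a ∉ run N (stepPriority w F i j) ∅ k := by
      intro hak
      obtain ⟨c, hck, hc⟩ := exists_mem_runEdges hak
      have hct : t ≤ i c := by
        refine Nat.sInf_le (Or.inr ⟨c, ?_, rfl⟩)
        rw [hfilter, stepEdges, runEdges_append]
        exact subset_runEdges _ _ hc
      have := (List.pairwise_append.1 hi).2.2 c hck b (by simp)
      omega
    have hlt : reserveGain w F N a b (k ++ b :: k') i j < w a * (1 - F (i b) (j a)) := by
      by_contra! hle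
      exact (Nat.sInf_le hle : θ ≤ j a).not_gt hjθ
    have haN : a ∈ N b \ run N (stepPriority w F i j) ∅ k := Finset.mem_sdiff.2 ⟨hab, hak⟩
    obtain ⟨z, hz⟩ := best_isSome (pr := stepPriority w F i j b) haN
    -- Another choice `z` would also be free in the run without `a`, so the reserve would be at
    -- least the value of `z`, hence that of `a`, against `hlt`.
    have hza : z = a := by
      by_contra hza
      have hzN := Finset.mem_sdiff.1 (best_spec hz).1
      have hzN' : z ∈ N b \ run N (stepPriority w F i j) {a} k := by
        rw [run_singleton_of_notMem hpr hak]
        simp [hzN.1, hzN.2, hza]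
      obtain ⟨c, hc⟩ := best_isSome (pr := stepPriority w F i j b) hzN'
      have h1 := le_of_stepPriority_le ((best_spec hc).2 z hzN')
      have h2 := le_of_stepPriority_le ((best_spec hz).2 a haN)
      rw [reserveGain, htake, hc] at hlt
      exact (h2.trans h1).not_gt hlt
    subst hza
    have hM := mem_runEdges_of_best k k' hz
    have h1 := le_offlineGain hF hw i j hM
    have h2 := le_onlineGain hF hw i j hM
    unfold stepEdges
    linarith
  · rw [if_neg hcase, mul_add, add_comm]
    exact add_le_add hoff (hcrit.trans hres)

/-- The value of a matching is at least the gain of the endpoints of any other one. -/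
theorem sum_gain_le (hF : IsStepPricing n F) (hw : ∀ a, 0 ≤ w a) (M M' : Finset (L × R))
    (hM' : ∀ e ∈ M', ∀ e' ∈ M', e.1 = e'.1 ∨ e.2 = e'.2 → e = e') (i : R → ℕ) (j : L → ℕ) :
    ∑ e ∈ M', (offlineGain w F M i j e.1 + onlineGain w F M i j e.2) ≤ ∑ e ∈ M, w e.1 := by
  have h1 : ∑ e ∈ M', offlineGain w F M i j e.1 ≤ ∑ e ∈ M, w e.1 * F (i e.2) (j e.1) := by
    rw [← Finset.sum_image (s := M') (g := Prod.fst) (f := offlineGain w F M i j)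
      fun e he e' he' h => hM' e he e' he' (Or.inl h)]
    unfold offlineGain
    exact Finset.sum_fiberwise_le_sum_of_sum_fiber_nonneg (g := Prod.fst) fun a _ =>
      offlineGain_nonneg hF hw M i j a
  have h2 : ∑ e ∈ M', onlineGain w F M i j e.2 ≤ ∑ e ∈ M, w e.1 * (1 - F (i e.2) (j e.1)) := by
    rw [← Finset.sum_image (s := M') (g := Prod.snd) (f := onlineGain w F M i j)
      fun e he e' he' h => hM' e he e' he' (Or.inr h)]
    unfold onlineGain
    exact Finset.sum_fiberwise_le_sum_of_sum_fiber_nonneg (g := Prod.snd) fun b _ =>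
      onlineGain_nonneg hF hw M i j b
  rw [Finset.sum_add_distrib]
  refine (add_le_add h1 h2).trans_eq ?_
  rw [← Finset.sum_add_distrib]
  exact Finset.sum_congr rfl fun e _ => by ring

/-! ### What the critical cells do not depend on -/

/-- The run behind `reserveGain` starts with `a` already matched, so the priority of `a` is never
consulted. -/
theorem critCell_update (a : L) (b : R) (hab : a ∈ N b) (l : List R) (i : R → ℕ) (j : L → ℕ)
    (s : ℕ) :
    critCell w F N a b l i (Function.update j a s) = critCell w F N a b l i j := by
  have hpr : ∀ c, ∀ z ≠ a, stepPriority w F i (Function.update j a s) c z =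
      stepPriority w F i j c z := by
    intro c z hz
    simp [stepPriority, hz]
  have hrun : ∀ k : List R, run N (stepPriority w F i (Function.update j a s)) {a} k =
      run N (stepPriority w F i j) {a} k := fun k =>
    run_congr (stepPriority_injective w F i j) fun c _ z hz => hpr c z (by simpa using hz)
  have hres : reserveGain w F N a b l i (Function.update j a s) = reserveGain w F N a b l i j := by
    have hne : ∀ z ∈ N b \ run N (stepPriority w F i j) {a} (l.takeWhile (· ≠ b)), z ≠ a := by
      rintro z hz rfl
      exact (Finset.mem_sdiff.1 hz).2 (subset_run _ _ (by simp))
    unfold reserveGain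
    rw [hrun, best_congr (stepPriority_injective w F i j b) fun z hz => hpr b z (hne z hz)]
    cases hz : best (stepPriority w F i j b)
        (N b \ run N (stepPriority w F i j) {a} (l.takeWhile (· ≠ b))) with
    | none => rfl
    | some z =>
      simp only [Option.elim_some]
      rw [Function.update_of_ne (hne z (best_spec hz).1)]
  unfold critCell
  rw [hres]

theorem runEdges_congr {α : Type*} [LinearOrder α] {pr pr' : R → L → α} {M : Finset (L × R)}
    {l : List R} (h : ∀ b ∈ l, pr b = pr' b) : runEdges N pr M l = runEdges N pr' M l := by
  induction l generalizing M with
  | nil => rfl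
  | cons b l ih =>
    simp only [runEdges, List.foldl_cons] at ih ⊢
    rw [h b (by simp)]
    exact ih fun c hc => h c (by simp [hc])

/-- Two lists are allowed because resampling the time of `b` moves `b` within the arrival order;
only the order of the others enters. -/
theorem matchCell_update (a : L) (b : R) {l l' : List R}
    (hl : l.filter (· ≠ b) = l'.filter (· ≠ b)) (i : R → ℕ) (j : L → ℕ) (s : ℕ) :
    matchCell n w F N a b l (Function.update i b s) j = matchCell n w F N a b l' i j := by
  have hE : stepEdges w F N (l.filter (· ≠ b)) (Function.update i b s) j =
      stepEdges w F N (l'.filter (· ≠ b)) i j := by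
    rw [hl]
    refine runEdges_congr fun c hc => ?_
    have : c ≠ b := by simpa using (List.mem_filter.1 hc).2
    funext z
    simp [stepPriority, this]
  unfold matchCell
  rw [hE]
  congr 2
  ext t
  refine exists_congr fun c => and_congr_right fun hc => ?_
  obtain ⟨k, k', hk, -⟩ := exists_prefix_of_mem_runEdges hc
  have : c ∈ l'.filter (· ≠ b) := by rw [hk]; simp
  have : c ≠ b := by simpa using (List.mem_filter.1 this).2
  rw [Function.update_of_ne this]

end Pointwise

/-! ### Sorting commutes with deleting elements -/

section Sorting

variable {R : Type*}

theorem orderedInsert_congr {r r' : R → R → Prop} [DecidableRel r] [DecidableRel r'] {a : R}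
    {l : List R} (h : ∀ b ∈ l, (r a b ↔ r' a b)) :
    l.orderedInsert r a = l.orderedInsert r' a := by
  induction l with
  | nil => rfl
  | cons c l ih =>
    simp only [List.orderedInsert_cons, h c (by simp)]
    rw [ih fun b hb => h b (by simp [hb])]

theorem insertionSort_congr {r r' : R → R → Prop} [DecidableRel r] [DecidableRel r']
    {l : List R} (h : ∀ a ∈ l, ∀ b ∈ l, (r a b ↔ r' a b)) :
    l.insertionSort r = l.insertionSort r' := by
  induction l with
  | nil => rfl
  | cons c l ih =>
    rw [List.insertionSort_cons, List.insertionSort_cons,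
      ← ih fun a ha b hb => h a (by simp [ha]) b (by simp [hb])]
    exact orderedInsert_congr fun b hb =>
      h c (by simp) b (List.mem_cons_of_mem _ ((List.mem_insertionSort r).1 hb))

/-- Sortedness matters when `a` is inserted before an element that the filter deletes: by
transitivity `a` still precedes all that remain. -/
theorem filter_orderedInsert (r : R → R → Prop) [DecidableRel r] [IsTrans R r] (p : R → Bool)
    (a : R) {l : List R} (hl : l.Pairwise r) :
    (l.orderedInsert r a).filter p =
      if p a then (l.filter p).orderedInsert r a else l.filter p := by
  induction l with
  | nil => cases hp : p a <;> simp [hp]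
  | cons c l ih =>
    obtain ⟨hc, hl⟩ := List.pairwise_cons.1 hl
    rw [List.orderedInsert_cons]
    by_cases hac : r a c
    · rw [if_pos hac]
      cases hp : p a with
      | false => rw [List.filter_cons_of_neg (by simp [hp])]; simp
      | true =>
        rw [List.filter_cons_of_pos hp, if_pos rfl]
        have hall : ∀ b ∈ (c :: l).filter p, r a b := by
          intro b hb
          rcases List.mem_cons.1 (List.mem_filter.1 hb).1 with rfl | hb
          · exact hac
          · exact _root_.trans hac (hc b hb)
        cases hf : (c :: l).filter p with
        | nil => rfl
        | cons d m => exact (List.orderedInsert_cons_of_le r m (hall d (by simp [hf]))).symm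
    · rw [if_neg hac]
      cases hpc : p c with
      | false =>
        rw [List.filter_cons_of_neg (by simp [hpc]), List.filter_cons_of_neg (by simp [hpc]), ih hl]
      | true =>
        rw [List.filter_cons_of_pos hpc, List.filter_cons_of_pos hpc, ih hl]
        cases hp : p a with
        | false => simp
        | true => simp [List.orderedInsert_cons, hac]

theorem filter_insertionSort (r : R → R → Prop) [DecidableRel r] [IsTrans R r] [Std.Total r]
    (p : R → Bool) (l : List R) :
    (l.insertionSort r).filter p = (l.filter p).insertionSort r := by
  induction l with
  | nil => rfl
  | cons a l ih =>
    rw [List.insertionSort_cons, filter_orderedInsert r p a (List.pairwise_insertionSort r l), ih]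
    cases hp : p a with
    | false => rw [List.filter_cons_of_neg (by simp [hp])]; simp
    | true => rw [List.filter_cons_of_pos hp, List.insertionSort_cons]; simp

end Sorting

/-! ### The arrival order and its dependence on a single arrival time -/

namespace WeightedBipartite

section ArrivalOrder

variable {R : Type*} [Fintype R] [LinearOrder R]

theorem arrivalOrder_congr {x x' : R → unitInterval} (h : ∀ b c, x b ≤ x c ↔ x' b ≤ x' c) :
    arrivalOrder x = arrivalOrder x' :=
  insertionSort_congr fun b _ c _ => h b c

instance total_onFun (x : R → unitInterval) : Std.Total fun b c => x b ≤ x c :=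
  ⟨fun b c => le_total (x b) (x c)⟩

instance isTrans_onFun (x : R → unitInterval) : IsTrans R fun b c => x b ≤ x c :=
  ⟨fun _ _ _ h h' => le_trans h h'⟩

theorem filter_arrivalOrder_update (x : R → unitInterval) (b : R) (s : unitInterval) :
    (arrivalOrder (Function.update x b s)).filter (· ≠ b) = (arrivalOrder x).filter (· ≠ b) := by
  unfold arrivalOrder
  rw [filter_insertionSort, filter_insertionSort]
  refine insertionSort_congr fun c hc d hd => ?_
  have hc : c ≠ b := by simpa using (List.mem_filter.1 hc).2
  have hd : d ≠ b := by simpa using (List.mem_filter.1 hd).2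
  simp [hc, hd]

theorem mem_arrivalOrder (x : R → unitInterval) (b : R) : b ∈ arrivalOrder x := by
  simp [arrivalOrder]

theorem nodup_arrivalOrder (x : R → unitInterval) : (arrivalOrder x).Nodup :=
  (List.perm_insertionSort _ _).nodup_iff.2 (Finset.sort_nodup _ _)

theorem pairwise_arrivalOrder (x : R → unitInterval) :
    (arrivalOrder x).Pairwise fun b c => x b ≤ x c :=
  List.pairwise_insertionSort _ _

end ArrivalOrder

end WeightedBipartite

/-! ### Cells of the unit interval and resampling of one coordinate -/

section Resampling

/-- The index of the cell of `t` in the partition of the unit interval into `n` equal cells. -/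
noncomputable def cell (n : ℕ) (t : unitInterval) : ℕ := ⌊(n : ℝ) * t⌋₊

theorem cell_mono (n : ℕ) : Monotone (cell n) := fun _ _ h =>
  Nat.floor_mono (mul_le_mul_of_nonneg_left h (Nat.cast_nonneg n))

theorem cell_one (n : ℕ) : cell n 1 = n := by simp [cell]

theorem cell_le (n : ℕ) (t : unitInterval) : cell n t ≤ n :=
  (cell_mono n t.2.2).trans_eq (cell_one n)

theorem cell_lt {n : ℕ} (hn : 0 < n) {t : unitInterval} (ht : t < 1) : cell n t < n := by
  have ht' : (t : ℝ) < 1 := ht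
  have hn' : (0 : ℝ) < n := by exact_mod_cast hn
  rw [cell, Nat.floor_lt (mul_nonneg hn'.le t.2.1)]
  nlinarith

theorem measurable_cell (n : ℕ) : Measurable (cell n) :=
  Nat.measurable_floor.comp (measurable_const.mul measurable_subtype_coe)

theorem cell_comp_update {ι : Type*} [DecidableEq ι] (n : ℕ) (z : ι → unitInterval) (c : ι)
    (s : unitInterval) : (fun d => cell n (Function.update z c s d)) =
      Function.update (fun d => cell n (z d)) c (cell n s) :=
  Function.comp_update (cell n) z c s

theorem volume_cell {n c : ℕ} (hc : c < n) :
    (volume : Measure unitInterval).real (cell n ⁻¹' {c}) = 1 / n := by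
  have hn' : (0 : ℝ) < n := by exact_mod_cast (Nat.zero_le c).trans_lt hc
  have hc' : (c : ℝ) + 1 ≤ n := by exact_mod_cast hc
  have h0 : (0 : ℝ) ≤ c := Nat.cast_nonneg c
  have hset : cell n ⁻¹' {c} = Set.Ico
      (⟨c / n, div_nonneg h0 hn'.le, (div_le_one hn').2 (by linarith)⟩ : unitInterval)
      ⟨(c + 1) / n, div_nonneg (by linarith) hn'.le, (div_le_one hn').2 hc'⟩ := by
    ext t
    have : cell n t = c ↔ (c : ℝ) ≤ n * t ∧ (n : ℝ) * t < c + 1 :=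
      Nat.floor_eq_iff (mul_nonneg hn'.le t.2.1)
    rw [Set.mem_preimage, Set.mem_singleton_iff, this, Set.mem_Ico, ← Subtype.coe_le_coe,
      ← Subtype.coe_lt_coe, div_le_iff₀ hn', lt_div_iff₀ hn', mul_comm (n : ℝ)]
  rw [hset, measureReal_def, unitInterval.volume_Ico, ENNReal.toReal_ofReal]
  · ring
  · have h : (c : ℝ) / n ≤ (c + 1) / n := div_le_div_of_nonneg_right (by linarith) hn'.le
    exact sub_nonneg.2 h

theorem integral_comp_cell {n : ℕ} (hn : 0 < n) (h : ℕ → ℝ) :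
    ∫ t, h (cell n t) = 1 / n * ∑ c ∈ Finset.range n, h c := by
  have hmeas : ∀ c, MeasurableSet (cell n ⁻¹' {c}) := fun c =>
    measurable_cell n (measurableSet_singleton c)
  have hae : (fun t => h (cell n t)) =ᵐ[volume]
      fun t => ∑ c ∈ Finset.range n, (cell n ⁻¹' {c}).indicator (fun _ => h c) t := by
    -- The cell of index `n` is the single point `1`, so it drops out of the average.
    have h1 : ∀ᵐ t : unitInterval, t ≠ 1 := by simp [ae_iff]
    filter_upwards [h1] with t ht
    have hlt : cell n t < n := cell_lt hn (lt_of_le_of_ne t.2.2 ht)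
    rw [Finset.sum_eq_single_of_mem (cell n t) (Finset.mem_range.2 hlt)]
    · simp
    · intro c _ hct
      have hmem : t ∉ cell n ⁻¹' {c} := fun hmem => hct (Set.mem_singleton_iff.1 hmem).symm
      rw [Set.indicator_of_notMem hmem]
  rw [integral_congr_ae hae, integral_finsetSum _ fun c _ =>
    (integrable_const _).indicator (hmeas c), Finset.mul_sum]
  refine Finset.sum_congr rfl fun c hc => ?_
  rw [integral_indicator_const _ (hmeas c), volume_cell (Finset.mem_range.1 hc), smul_eq_mul]

theorem measurePreserving_update {ι : Type*} [Fintype ι] [DecidableEq ι] (a : ι) :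
    MeasurePreserving (fun q : (ι → unitInterval) × unitInterval => Function.update q.1 a q.2) := by
  have hmeas : Measurable fun q : (ι → unitInterval) × unitInterval =>
      Function.update q.1 a q.2 := by
    refine measurable_pi_lambda _ fun c => ?_
    by_cases hc : c = a
    · subst hc; simpa using measurable_snd
    · simpa [hc, Function.comp_def] using (measurable_pi_apply c).comp measurable_fst
  refine ⟨hmeas, ?_⟩
  refine (Measure.pi_eq fun s hs => ?_).symm
  rw [Measure.map_apply hmeas (MeasurableSet.univ_pi hs)]
  have hset : (fun q : (ι → unitInterval) × unitInterval => Function.update q.1 a q.2) ⁻¹'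
      Set.univ.pi s = (Set.univ.pi (Function.update s a Set.univ)) ×ˢ s a := by
    ext q
    simp only [Set.mem_preimage, Set.mem_pi, Set.mem_univ, true_imp_iff, Set.mem_prod]
    constructor
    · intro h
      refine ⟨fun c => ?_, by simpa using h a⟩
      by_cases hc : c = a
      · subst hc; simp
      · simpa [hc] using h c
    · rintro ⟨h, ha⟩ c
      by_cases hc : c = a
      · subst hc; simpa using ha
      · simpa [hc] using h c
  rw [hset, Measure.volume_eq_prod, Measure.prod_prod, volume_pi, Measure.pi_pi,
    ← Finset.mul_prod_erase Finset.univ _ (Finset.mem_univ a),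
    ← Finset.mul_prod_erase Finset.univ (fun c => volume (s c)) (Finset.mem_univ a)]
  simp only [Function.update_self, measure_univ, one_mul]
  rw [mul_comm]
  congr 1
  exact Finset.prod_congr rfl fun c hc => by
    rw [Function.update_of_ne (Finset.ne_of_mem_erase hc)]

variable {L R : Type*} [Fintype L] [Fintype R]

theorem measurePreserving_update_right [DecidableEq L] (a : L) : MeasurePreserving
    fun q : ((R → unitInterval) × (L → unitInterval)) × unitInterval =>
      (q.1.1, Function.update q.1.2 a q.2) :=
  ((MeasurePreserving.id _).prod (measurePreserving_update a)).comp
    (measurePreserving_prodAssoc volume volume volume)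

theorem measurePreserving_update_left [DecidableEq R] (b : R) : MeasurePreserving
    fun q : ((R → unitInterval) × (L → unitInterval)) × unitInterval =>
      (Function.update q.1.1 b q.2, q.1.2) := by
  have hswap : MeasurePreserving (Prod.swap : (R → unitInterval) × (L → unitInterval) → _)
      volume volume := Measure.measurePreserving_swap
  have hswap' : MeasurePreserving (Prod.swap : (L → unitInterval) × (R → unitInterval) → _)
      volume volume := Measure.measurePreserving_swap
  exact (hswap'.comp (measurePreserving_update_right (R := L) b)).comp
    (hswap.prod (MeasurePreserving.id volume))

/-- Replacing the coordinate `κ` by a fresh uniform one keeps the law. Since `h c` ignores that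
coordinate, integrating over it first averages over its cells. -/
theorem integral_resample {Ω : Type*} [MeasureSpace Ω] [IsProbabilityMeasure (volume : Measure Ω)]
    {n : ℕ} (hn : 0 < n) {κ : Ω → unitInterval} {U : Ω × unitInterval → Ω}
    (hU : MeasurePreserving U) (hκ : ∀ p t, κ (U (p, t)) = t) {h : ℕ → Ω → ℝ}
    (hh : ∀ c p t, h c (U (p, t)) = h c p) (hint : Integrable fun p => h (cell n (κ p)) p) :
    ∫ p, h (cell n (κ p)) p = ∫ p, 1 / n * ∑ c ∈ Finset.range n, h c p := by
  have hint' : Integrable fun q => h (cell n (κ (U q))) (U q) :=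
    hU.integrable_comp_of_integrable hint
  have h1 : ∫ p, h (cell n (κ p)) p = ∫ q, h (cell n (κ (U q))) (U q) := by
    have hi := hint.aestronglyMeasurable
    rw [← hU.map_eq] at hi
    conv_lhs => rw [← hU.map_eq]
    exact integral_map hU.aemeasurable hi
  rw [h1, Measure.volume_eq_prod, integral_prod _ hint']
  simp only [hκ, hh]
  exact integral_congr_ae (Filter.Eventually.of_forall fun p =>
    integral_comp_cell hn fun c => h c p)

end Resampling

/-! ### Integrability by reduction to a finite space -/

section Discrete

variable {L R : Type*} [Fintype L] [Fintype R] [LinearOrder R]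

/-- A random variable that depends only on the order of arrival and on the cells of the arrival
times and ranks is integrable. -/
theorem integrable_of_cells (n : ℕ) (Φ : List R → (R → ℕ) → (L → ℕ) → ℝ) :
    Integrable fun p : (R → unitInterval) × (L → unitInterval) =>
      Φ (WeightedBipartite.arrivalOrder p.1) (fun b => cell n (p.1 b)) fun a => cell n (p.2 a) := by
  let D : (R → unitInterval) × (L → unitInterval) →
      (R → R → Prop) × (R → Fin (n + 1)) × (L → Fin (n + 1)) := fun p =>
    (fun b c => p.1 b ≤ p.1 c, fun b => ⟨cell n (p.1 b), Nat.lt_succ_of_le (cell_le n _)⟩,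
      fun a => ⟨cell n (p.2 a), Nat.lt_succ_of_le (cell_le n _)⟩)
  have hcell : Measurable fun t : unitInterval =>
      (⟨cell n t, Nat.lt_succ_of_le (cell_le n t)⟩ : Fin (n + 1)) :=
    measurable_to_countable' fun c => by
      have : (fun t : unitInterval => (⟨cell n t, Nat.lt_succ_of_le (cell_le n t)⟩ : Fin (n + 1)))
          ⁻¹' {c} = cell n ⁻¹' {(c : ℕ)} := by
        ext t; simp [Fin.ext_iff]
      rw [this]
      exact measurable_cell n (measurableSet_singleton _)
  have hD : Measurable D := by
    refine Measurable.prodMk ?_ (Measurable.prodMk ?_ ?_)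
    · refine measurable_pi_lambda _ fun b => measurable_pi_lambda _ fun c => ?_
      exact measurableSet_setOfPred.1 (measurableSet_le ((measurable_pi_apply b).comp measurable_fst)
        ((measurable_pi_apply c).comp measurable_fst))
    · exact measurable_pi_lambda _ fun b =>
        hcell.comp ((measurable_pi_apply b).comp measurable_fst)
    · exact measurable_pi_lambda _ fun a =>
        hcell.comp ((measurable_pi_apply a).comp measurable_snd)
  set g := fun p : (R → unitInterval) × (L → unitInterval) =>
    Φ (WeightedBipartite.arrivalOrder p.1) (fun b => cell n (p.1 b)) fun a => cell n (p.2 a)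
  -- `D` records the pairwise comparisons of arrival times and all cells, finitely many values in
  -- total, and these determine `g`.
  have hg : Function.FactorsThrough g D := by
    intro p p' h
    obtain ⟨h1, h2⟩ := Prod.mk.inj h
    obtain ⟨h2, h3⟩ := Prod.mk.inj h2
    have e1 : WeightedBipartite.arrivalOrder p.1 = WeightedBipartite.arrivalOrder p'.1 :=
      WeightedBipartite.arrivalOrder_congr fun b c => iff_of_eq (congrFun (congrFun h1 b) c)
    have e2 : (fun b => cell n (p.1 b)) = fun b => cell n (p'.1 b) :=
      funext fun b => Fin.mk.inj (congrFun h2 b)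
    have e3 : (fun a => cell n (p.2 a)) = fun a => cell n (p'.2 a) :=
      funext fun a => Fin.mk.inj (congrFun h3 a)
    change Φ _ _ _ = Φ _ _ _
    rw [e1, e2, e3]
  have hg' : g = Function.extend D g (fun _ => 0) ∘ D :=
    funext fun p => (hg.extend_apply _ p).symm
  rw [hg']
  exact Integrable.comp_measurable Integrable.of_finite hD

end Discrete

/-! ### The expected gain of an edge -/

section EdgeBound

variable {L R : Type*} [Fintype L] [LinearOrder L] [Fintype R] [LinearOrder R]

/-- The expected gain of the endpoints of an edge, bounded by a dual certificate: the gain of the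
pair is split into a part `m` that does not see the critical cell of the offline vertex and a part
`m'` that does not see the critical cell of the online vertex. -/
theorem le_integral_gain {n : ℕ} (hn : 0 < n) {F : ℕ → ℕ → ℝ} (hF : IsStepPricing n F)
    {m m' : ℕ → ℕ → ℕ → ℝ} (hm : ∀ i j t θ, m i j θ + m' i j t ≤ pairGain n F i j t θ)
    {C D : ℕ → ℝ} (hC : ∀ i ≤ n, ∀ θ ≤ n, C i ≤ ∑ j ∈ Finset.range n, m i j θ)
    (hD : ∀ j ≤ n, ∀ t ≤ n, D j ≤ ∑ i ∈ Finset.range n, m' i j t)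
    {w : L → ℝ} (hw : ∀ a, 0 ≤ w a) {N : R → Finset L} {a : L} {b : R} (hab : a ∈ N b) :
    w a * (1 / n * (1 / n * ∑ i ∈ Finset.range n, C i) +
        1 / n * (1 / n * ∑ j ∈ Finset.range n, D j)) ≤
      ∫ p : (R → unitInterval) × (L → unitInterval),
        (offlineGain w F (stepEdges w F N (WeightedBipartite.arrivalOrder p.1)
          (fun b => cell n (p.1 b)) fun a => cell n (p.2 a)) (fun b => cell n (p.1 b))
          (fun a => cell n (p.2 a)) a +
        onlineGain w F (stepEdges w F N (WeightedBipartite.arrivalOrder p.1)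
          (fun b => cell n (p.1 b)) fun a => cell n (p.2 a)) (fun b => cell n (p.1 b))
          (fun a => cell n (p.2 a)) b) := by
  have hn' : (0 : ℝ) ≤ 1 / n := by positivity
  set θ : (R → unitInterval) × (L → unitInterval) → ℕ := fun p =>
    critCell w F N a b (WeightedBipartite.arrivalOrder p.1) (fun b => cell n (p.1 b))
      fun a => cell n (p.2 a) with hθ
  set t : (R → unitInterval) × (L → unitInterval) → ℕ := fun p =>
    matchCell n w F N a b (WeightedBipartite.arrivalOrder p.1) (fun b => cell n (p.1 b))
      fun a => cell n (p.2 a) with ht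
  have hi1 : Integrable fun p : (R → unitInterval) × (L → unitInterval) =>
      m (cell n (p.1 b)) (cell n (p.2 a)) (θ p) :=
    integrable_of_cells n fun l i j => m (i b) (j a) (critCell w F N a b l i j)
  have hi2 : Integrable fun p : (R → unitInterval) × (L → unitInterval) =>
      m' (cell n (p.1 b)) (cell n (p.2 a)) (t p) :=
    integrable_of_cells n fun l i j => m' (i b) (j a) (matchCell n w F N a b l i j)
  have h1 : 1 / n * (1 / n * ∑ i ∈ Finset.range n, C i) ≤
      ∫ p : (R → unitInterval) × (L → unitInterval),
        m (cell n (p.1 b)) (cell n (p.2 a)) (θ p) := by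
    -- Resampling the rank of `a` leaves `θ` unchanged, so `m` is summed over `j` at fixed `i` and
    -- `θ`, as in `hC`.
    rw [integral_resample hn (measurePreserving_update_right (R := R) a) (κ := fun p => p.2 a)
      (h := fun c p => m (cell n (p.1 b)) c (θ p)) (fun p s => Function.update_self _ _ _)
      (fun c p s => by
        simp only [hθ]
        rw [cell_comp_update n p.2 a s, critCell_update a b hab]) hi1]
    have hC' : ∫ p : (R → unitInterval) × (L → unitInterval), 1 / n * C (cell n (p.1 b)) =
        1 / n * (1 / n * ∑ i ∈ Finset.range n, C i) := by
      rw [integral_const_mul, integral_resample hn (measurePreserving_update_left (L := L) b)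
        (κ := fun p => p.1 b) (h := fun c _ => C c) (fun p s => Function.update_self _ _ _)
        (fun _ _ _ => rfl) (integrable_of_cells n fun _ i _ => C (i b))]
      simp
    rw [← hC']
    refine integral_mono (integrable_of_cells n fun _ i _ => 1 / n * C (i b))
      (integrable_of_cells n fun l i j =>
        1 / n * ∑ c ∈ Finset.range n, m (i b) c (critCell w F N a b l i j)) fun p => ?_
    exact mul_le_mul_of_nonneg_left (hC _ (cell_le n _) _ (critCell_le hF hw ..)) hn'
  have h2 : 1 / n * (1 / n * ∑ j ∈ Finset.range n, D j) ≤
      ∫ p : (R → unitInterval) × (L → unitInterval),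
        m' (cell n (p.1 b)) (cell n (p.2 a)) (t p) := by
    -- Symmetrically, resampling the time of `b` leaves `t` unchanged.
    rw [integral_resample hn (measurePreserving_update_left (L := L) b) (κ := fun p => p.1 b)
      (h := fun c p => m' c (cell n (p.2 a)) (t p)) (fun p s => Function.update_self _ _ _)
      (fun c p s => by
        simp only [ht]
        rw [cell_comp_update n p.1 b s, matchCell_update a b
          (WeightedBipartite.filter_arrivalOrder_update p.1 b s)]) hi2]
    have hD' : ∫ p : (R → unitInterval) × (L → unitInterval), 1 / n * D (cell n (p.2 a)) =
        1 / n * (1 / n * ∑ j ∈ Finset.range n, D j) := by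
      rw [integral_const_mul, integral_resample hn (measurePreserving_update_right (R := R) a)
        (κ := fun p => p.2 a) (h := fun c _ => D c) (fun p s => Function.update_self _ _ _)
        (fun _ _ _ => rfl) (integrable_of_cells n fun _ _ j => D (j a))]
      simp
    rw [← hD']
    refine integral_mono (integrable_of_cells n fun _ _ j => 1 / n * D (j a))
      (integrable_of_cells n fun l i j =>
        1 / n * ∑ c ∈ Finset.range n, m' c (j a) (matchCell n w F N a b l i j)) fun p => ?_
    exact mul_le_mul_of_nonneg_left (hD _ (cell_le n _) _ (matchCell_le ..)) hn'
  calc w a * (1 / n * (1 / n * ∑ i ∈ Finset.range n, C i) +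
        1 / n * (1 / n * ∑ j ∈ Finset.range n, D j))
      ≤ w a * ∫ p : (R → unitInterval) × (L → unitInterval),
        (m (cell n (p.1 b)) (cell n (p.2 a)) (θ p) +
          m' (cell n (p.1 b)) (cell n (p.2 a)) (t p)) := by
        rw [integral_add hi1 hi2]
        exact mul_le_mul_of_nonneg_left (add_le_add h1 h2) (hw a)
    _ = ∫ p : (R → unitInterval) × (L → unitInterval),
        w a * (m (cell n (p.1 b)) (cell n (p.2 a)) (θ p) +
          m' (cell n (p.1 b)) (cell n (p.2 a)) (t p)) := (integral_const_mul _ _).symm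
    _ ≤ _ := by
        refine integral_mono ((hi1.add hi2).const_mul _) (integrable_of_cells n fun l i j =>
          offlineGain w F (stepEdges w F N l i j) i j a +
            onlineGain w F (stepEdges w F N l i j) i j b) fun p => ?_
        refine le_trans (mul_le_mul_of_nonneg_left (hm _ _ _ _) (hw a)) ?_
        exact pairGain_le hF hw (WeightedBipartite.nodup_arrivalOrder p.1)
          ((WeightedBipartite.pairwise_arrivalOrder p.1).imp fun h => cell_mono n h) _
          (WeightedBipartite.mem_arrivalOrder p.1 b) hab

end EdgeBound

/-! ### From step tables to the Ranking algorithm -/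

section StepPricing

/-- The pricing function that has the value `F i j` on the cell of index `(i, j)`. -/
noncomputable def stepPrice {n : ℕ} {F : ℕ → ℕ → ℝ} (hF : IsStepPricing n F)
    (x y : unitInterval) : unitInterval :=
  ⟨F (cell n x) (cell n y), hF.nonneg _ _, hF.le_one _ _⟩

theorem isPricing_stepPrice {n : ℕ} (hn : 0 < n) {F : ℕ → ℕ → ℝ} (hF : IsStepPricing n F)
    (hzero : ∀ j < n, F n j = 0) : IsPricing (stepPrice hF) where
  antitone_time y _ _ h := Subtype.mk_le_mk.2 (hF.antitone _ (cell_mono n h))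
  monotone_rank x _ _ h := Subtype.mk_le_mk.2 (hF.monotone _ (cell_mono n h))
  rank_one x := Subtype.ext (by simp [stepPrice, cell_one, hF.last])
  time_one y hy := Subtype.ext (by simp [stepPrice, cell_one, hzero _ (cell_lt hn hy)])

namespace WeightedBipartite

theorem exists_isMatching_value_eq_opt {L R : Type*} (G : WeightedBipartite L R) :
    ∃ M, G.IsMatching M ∧ G.value M = G.opt := by
  classical
  obtain ⟨M, hM, h⟩ := Finset.exists_mem_eq_sup' (s := G.edges.powerset.filter G.IsMatching)
    ⟨∅, by simp [IsMatching]⟩ G.value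
  refine ⟨M, (Finset.mem_filter.1 hM).2, h.symm.trans ?_⟩
  unfold opt
  congr!

variable {L R : Type*} [Fintype L] [LinearOrder L] [Fintype R] [LinearOrder R]

/-- The neighbours of the online vertex `b`. -/
def neighbors (G : WeightedBipartite L R) (b : R) : Finset L :=
  Finset.univ.filter fun a => (a, b) ∈ G.edges

variable {n : ℕ} {F : ℕ → ℕ → ℝ} (hF : IsStepPricing n F) (G : WeightedBipartite L R)

theorem available_eq (M : Finset (L × R)) (b : R) :
    G.available M b = G.neighbors b \ M.image Prod.fst := by
  ext a
  simp only [available, neighbors, Finset.mem_filter, Finset.mem_univ, true_and, Finset.mem_sdiff,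
    Finset.mem_image, not_exists, not_and]

theorem arrive_eq (x : R → unitInterval) (y : L → unitInterval) (M : Finset (L × R))
    (b : R) :
    G.arrive (stepPrice hF) x y M b = M ∪ ((best (stepPriority G.weight F (fun b => cell n (x b))
      (fun a => cell n (y a)) b) (G.neighbors b \ M.image Prod.fst)).map
        fun a => (a, b)).toFinset := by
  rw [← available_eq]
  change _ = M ∪ ((best (G.priority (stepPrice hF) x y b) _).map _).toFinset
  unfold arrive best
  split_ifs with h
  · ext; simp [or_comm]
  · simp

theorem ranking_eq (x : R → unitInterval) (y : L → unitInterval) :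
    G.ranking (stepPrice hF) x y = stepEdges G.weight F G.neighbors (arrivalOrder x)
      (fun b => cell n (x b)) fun a => cell n (y a) := by
  unfold ranking stepEdges runEdges
  congr 1
  funext M b
  exact arrive_eq hF G x y M b

theorem integrable_rankingValue : Integrable (G.rankingValue (stepPrice hF)) := by
  have : G.rankingValue (stepPrice hF) = fun p => G.value (stepEdges G.weight F G.neighbors
      (arrivalOrder p.1) (fun b => cell n (p.1 b)) fun a => cell n (p.2 a)) := by
    funext p
    rw [rankingValue, ranking_eq]
  rw [this]
  exact integrable_of_cells n fun l i j => G.value (stepEdges G.weight F G.neighbors l i j)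

/-- Linearity of expectation over the edges of an optimal matching, combined with the pointwise
bound `sum_gain_le`. -/
theorem mul_opt_le_integral_rankingValue {r : ℝ}
    (h : ∀ a b, a ∈ G.neighbors b → r * G.weight a ≤
      ∫ p : (R → unitInterval) × (L → unitInterval),
        (offlineGain G.weight F (stepEdges G.weight F G.neighbors (arrivalOrder p.1)
          (fun b => cell n (p.1 b)) fun a => cell n (p.2 a)) (fun b => cell n (p.1 b))
          (fun a => cell n (p.2 a)) a +
        onlineGain G.weight F (stepEdges G.weight F G.neighbors (arrivalOrder p.1)
          (fun b => cell n (p.1 b)) fun a => cell n (p.2 a)) (fun b => cell n (p.1 b))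
          (fun a => cell n (p.2 a)) b)) :
    r * G.opt ≤ ∫ p, G.rankingValue (stepPrice hF) p := by
  obtain ⟨M, hM, hopt⟩ := G.exists_isMatching_value_eq_opt
  have hint : ∀ e : L × R, Integrable fun p : (R → unitInterval) × (L → unitInterval) =>
      (offlineGain G.weight F (stepEdges G.weight F G.neighbors (arrivalOrder p.1)
          (fun b => cell n (p.1 b)) fun a => cell n (p.2 a)) (fun b => cell n (p.1 b))
          (fun a => cell n (p.2 a)) e.1 +
        onlineGain G.weight F (stepEdges G.weight F G.neighbors (arrivalOrder p.1)
          (fun b => cell n (p.1 b)) fun a => cell n (p.2 a)) (fun b => cell n (p.1 b))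
          (fun a => cell n (p.2 a)) e.2) := fun e =>
    integrable_of_cells n fun l i j =>
      offlineGain G.weight F (stepEdges G.weight F G.neighbors l i j) i j e.1 +
        onlineGain G.weight F (stepEdges G.weight F G.neighbors l i j) i j e.2
  rw [← hopt, value, Finset.mul_sum]
  refine (Finset.sum_le_sum fun e he => h e.1 e.2 ?_).trans ?_
  · simpa [neighbors] using hM.1 he
  rw [← integral_finsetSum _ fun e _ => hint e]
  refine integral_mono (integrable_finsetSum _ fun e _ => hint e)
    (integrable_rankingValue hF G) fun p => ?_
  rw [rankingValue, ranking_eq, value]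
  exact sum_gain_le hF G.weight_nonneg _ M hM.2 _ _

end WeightedBipartite

end StepPricing

/-! ### The numerical price table and its dual certificate -/

section Certificate

/-- The pricing function in the cells of the `12 × 12` grid, in thousandths. -/
def priceTable : List (List ℕ) :=
  [
   [500, 536, 568, 600, 630, 663, 696, 728, 765, 803, 845, 909],
   [464, 500, 532, 565, 596, 633, 668, 704, 743, 785, 830, 900],
   [432, 468, 500, 531, 566, 598, 636, 674, 718, 763, 813, 890],
   [400, 435, 469, 500, 531, 566, 599, 638, 686, 744, 805, 890],
   [370, 404, 434, 469, 500, 532, 574, 606, 659, 720, 793, 880],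
   [337, 367, 402, 434, 468, 500, 533, 582, 634, 700, 773, 869],
   [304, 332, 364, 401, 426, 467, 500, 546, 602, 664, 751, 858],
   [272, 296, 326, 362, 394, 418, 454, 500, 559, 622, 710, 827],
   [235, 257, 282, 314, 341, 366, 398, 441, 500, 568, 668, 799],
   [197, 215, 237, 256, 280, 300, 336, 378, 432, 500, 599, 738],
   [155, 170, 187, 195, 207, 227, 249, 290, 332, 401, 500, 654],
   [91, 100, 110, 110, 120, 131, 142, 173, 201, 262, 346, 500]]

/-- The dual certificate in the cells of the `12 × 12` grid, in thousandths. -/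
def dualTable : List (List ℕ) :=
  [
   [898, 933, 967, 988, 1000, 1000, 1000, 1000, 1000, 1000, 1000, 1000],
   [785, 821, 852, 900, 900, 981, 1000, 1000, 1000, 1000, 1000, 1000],
   [718, 763, 782, 813, 880, 890, 958, 1000, 1000, 935, 891, 992],
   [638, 686, 744, 744, 780, 831, 805, 892, 902, 938, 1000, 1000],
   [606, 659, 659, 717, 721, 757, 861, 770, 852, 1000, 1000, 1000],
   [533, 582, 634, 634, 717, 695, 760, 835, 983, 1000, 1000, 1000],
   [467, 509, 550, 592, 587, 766, 814, 916, 1000, 1000, 1000, 1000],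
   [418, 454, 501, 606, 662, 730, 952, 1000, 1000, 1000, 1000, 1000],
   [348, 380, 465, 603, 707, 934, 1000, 1000, 1000, 1000, 1000, 1000],
   [280, 362, 469, 645, 1000, 1000, 1000, 1000, 1000, 1000, 1000, 1000],
   [230, 428, 581, 1000, 1000, 1000, 1000, 1000, 1000, 1000, 1000, 1000],
   [294, 618, 994, 1000, 1000, 1000, 1000, 1000, 1000, 1000, 1000, 1000]]

/-- Lower bounds, in thousandths, for the row sums of the dual certificate. -/
def rowBound (i : ℕ) : ℤ :=
  ([11784, 11236, 10618, 9955, 9600, 9372, 9198, 9323, 9436, 9756, 10239, 10906] : List ℤ).getD i 0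

/-- Lower bounds, in thousandths, for the column sums of the dual certificate. -/
def colBound (j : ℕ) : ℤ :=
  ([-216, -764, -1382, -2045, -2400, -2628, -2802, -2677, -2564, -2244, -1761, -1094] : List ℤ).getD j 0

/-- The entries of `priceTable`, extended to arrival time `1` and rank `1`. -/
def price (i j : ℕ) : ℕ := if 12 ≤ j then 1000 else (priceTable.getD i []).getD j 0

/-- The price at a time cell at which an offline vertex is matched; index `12` means that it stays
unmatched. -/
def matchedPrice (t j : ℕ) : ℕ := if t = 12 then 0 else price t j

/-- The upper dual variable of a cell. -/
def upperDual (i j : ℕ) : ℕ := (dualTable.getD i []).getD j 0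

/-- The lower dual variable of a cell, which mirrors the upper one of the transposed cell. -/
def lowerDual (i j : ℕ) : ℕ := if i < 12 ∧ j < 12 then 1000 - upperDual j i else 0

/-- The part of the certificate that depends on the critical cell of the online vertex. -/
def rowTerm (i j θ : ℕ) : ℤ :=
  1000 - price i θ + if j < θ then min (upperDual i j) (price i θ) else lowerDual i j

/-- The part of the certificate that depends on the critical cell of the offline vertex. -/
def colTerm (i j t : ℕ) : ℤ :=
  matchedPrice t j - if i < t then max (lowerDual i j) (matchedPrice t j) else upperDual i j

theorem price_eq_zero {i j : ℕ} (hi : 12 ≤ i) (hj : j < 12) : price i j = 0 := by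
  have : priceTable.getD i [] = [] := List.getD_eq_default _ _ hi
  rw [price, if_neg hj.not_ge, this]
  rfl

theorem price_succ_left_le (i j : ℕ) : price (i + 1) j ≤ price i j := by
  rcases le_or_gt 12 j with hj | hj
  · simp [price, hj]
  rcases le_or_gt 12 i with hi | hi
  · rw [price_eq_zero (hi.trans (Nat.le_succ i)) hj]
    exact Nat.zero_le _
  · have h : ∀ i < 12, ∀ j < 12, price (i + 1) j ≤ price i j := by decide +kernel
    exact h i hi j hj

theorem price_le_succ_right (i j : ℕ) : price i j ≤ price i (j + 1) := by
  rcases le_or_gt 12 j with hj | hj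
  · simp [price, hj, hj.trans (Nat.le_succ j)]
  rcases le_or_gt 12 i with hi | hi
  · rw [price_eq_zero hi hj]
    exact Nat.zero_le _
  · have h : ∀ i < 12, ∀ j < 12, price i j ≤ price i (j + 1) := by decide +kernel
    exact h i hi j hj

theorem price_last (i : ℕ) {j : ℕ} (hj : 12 ≤ j) : price i j = 1000 := if_pos hj

theorem price_le (i j : ℕ) : price i j ≤ 1000 := by
  rw [← price_last i (le_max_left 12 j)]
  exact monotone_nat_of_le_succ (price_le_succ_right i) (le_max_right 12 j)

theorem isStepPricing_price : IsStepPricing 12 fun i j => (price i j : ℝ) / 1000 where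
  nonneg i j := by positivity
  le_one i j := by
    rw [div_le_one (by norm_num)]
    exact_mod_cast price_le i j
  antitone j i i' h := by
    have := antitone_nat_of_succ_le (f := fun i => price i j) (fun i => price_succ_left_le i j) h
    exact div_le_div_of_nonneg_right (by exact_mod_cast this) (by norm_num)
  monotone i j j' h := by
    have := monotone_nat_of_le_succ (price_le_succ_right i) h
    exact div_le_div_of_nonneg_right (by exact_mod_cast this) (by norm_num)
  last i := by simp [price_last]

theorem lowerDual_le_upperDual (i j : ℕ) : lowerDual i j ≤ upperDual i j := by
  by_cases h : i < 12 ∧ j < 12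
  · have h' : ∀ i < 12, ∀ j < 12, lowerDual i j ≤ upperDual i j := by decide +kernel
    exact h' i h.1 j h.2
  · simp [lowerDual, h]

/-- Beyond `1000 - price i θ + matchedPrice t j`, the excess is a row dual minus a column dual. When
`i < t` and `j < θ`, the `min` and the `max` cancel the two prices; in the other cases the
difference is at most `0`, using `lowerDual_le_upperDual` when both conditions fail. -/
theorem rowTerm_add_colTerm_le (i j t θ : ℕ) : rowTerm i j θ + colTerm i j t ≤
    if i < t ∧ j < θ then 1000 else 1000 - (price i θ : ℤ) + matchedPrice t j := by
  have h := lowerDual_le_upperDual i j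
  unfold rowTerm colTerm
  split_ifs <;> omega

/-- The index `i = 12` is arrival time `1`, a null event, included because the bound is used
pointwise; there `rowBound` takes the default `0`. For `θ`, index `12` is a genuine case: `a` beats
the reserve at every rank cell below `12`. -/
theorem rowBound_le : ∀ i < 13, ∀ θ < 13, rowBound i ≤ ∑ j ∈ Finset.range 12, rowTerm i j θ := by
  decide +kernel

theorem colBound_le : ∀ j < 13, ∀ t < 13, colBound j ≤ ∑ i ∈ Finset.range 12, colTerm i j t := by
  decide +kernel

theorem le_sum_bounds : 98813 ≤
    ∑ i ∈ Finset.range 12, rowBound i + ∑ j ∈ Finset.range 12, colBound j := by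
  decide +kernel

theorem certificate_le_pairGain (i j t θ : ℕ) : (rowTerm i j θ : ℝ) / 1000 + colTerm i j t / 1000 ≤
    pairGain 12 (fun i j => (price i j : ℝ) / 1000) i j t θ := by
  have h := rowTerm_add_colTerm_le i j t θ
  unfold pairGain
  unfold matchedPrice at h
  split_ifs at h ⊢
  all_goals
    have h' := (Int.cast_le (R := ℝ)).2 h
    push_cast at h'
    linarith

end Certificate

end OnlineMatching

theorem theorem1 :
    ∃ f : unitInterval → unitInterval → unitInterval, OnlineMatching.IsPricing f ∧
      ∀ (L : Type u) (R : Type v) [Fintype L] [LinearOrder L] [Fintype R] [LinearOrder R]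
        (G : OnlineMatching.WeightedBipartite L R),
        Integrable (G.rankingValue f) volume ∧
          (0.6862 : ℝ) * G.opt ≤ ∫ p, G.rankingValue f p := by
  have hF := OnlineMatching.isStepPricing_price
  refine ⟨OnlineMatching.stepPrice hF,
    OnlineMatching.isPricing_stepPrice (by norm_num) hF fun j hj => ?_, ?_⟩
  · simp [OnlineMatching.price_eq_zero le_rfl hj]
  intro L R _ _ _ _ G
  refine ⟨G.integrable_rankingValue hF, G.mul_opt_le_integral_rankingValue hF fun a b hab => ?_⟩
  refine le_trans ?_ (OnlineMatching.le_integral_gain (by norm_num) hF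
    (m := fun i j θ => (OnlineMatching.rowTerm i j θ : ℝ) / 1000)
    (m' := fun i j t => (OnlineMatching.colTerm i j t : ℝ) / 1000)
    OnlineMatching.certificate_le_pairGain
    (C := fun i => (OnlineMatching.rowBound i : ℝ) / 1000)
    (D := fun j => (OnlineMatching.colBound j : ℝ) / 1000)
    (fun i hi θ hθ => ?_) (fun j hj t ht => ?_) G.weight_nonneg hab)
  -- The margin is thin: `0.6862 * 144 = 98.8128`.
  · have h : ((98813 : ℤ) : ℝ) ≤ _ := Int.cast_le.2 OnlineMatching.le_sum_bounds
    push_cast at h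
    rw [mul_comm]
    refine mul_le_mul_of_nonneg_left ?_ (G.weight_nonneg a)
    rw [← Finset.sum_div, ← Finset.sum_div]
    push_cast
    linarith
  · rw [← Finset.sum_div]
    refine div_le_div_of_nonneg_right ?_ (by norm_num)
    exact_mod_cast OnlineMatching.rowBound_le i (Nat.lt_succ_of_le hi) θ (Nat.lt_succ_of_le hθ)
  · rw [← Finset.sum_div]
    refine div_le_div_of_nonneg_right ?_ (by norm_num)
    exact_mod_cast OnlineMatching.colBound_le j (Nat.lt_succ_of_le hj) t (Nat.lt_succ_of_le ht)
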